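/- For a form $F\in\mathbb{C}[x,y]$ of degree $d$, its (complex) Waring rank $\operatorname{rk}(F)$ is the least $n$ such that $F=a_1L_1^d+\dots+a_nL_n^d$ for some scalars $a_1,\dots,a_n\in\mathbb{C}$ and some linear forms $L_1,\dots,L_n\in\mathbb{C}[x,y]$. Let $r,s,\alpha$ be integers with $0\le r\le s$ and $\alpha\ge 1$, let $a,b\in\mathbb{C}\setminus\{0\}$, and let $$F=a\,x^r y^{s+\alpha}+b\,x^{r+\alpha}y^s,$$ a binary form of degree $d=r+s+\alpha$. Let $q,j$ be the unique nonnegative integers with $r=q\alpha+j$ and $0\le j<\alpha$, and set $\delta=r+\alpha-s\in\mathbb{Z}$. Then $$\operatorname{rk}(F)=\begin{cases} s+1 & \text{if } \delta\le 0,\\ s+2 & \text{if } \delta>0,\ j=0,\ r=s \text{ and } \alpha>1,\\ s+1 & \text{if } \delta>0 \text{ and } j=\delta,\\ r+\alpha+1 & \text{if } \delta>0 \text{ and } j>\delta,\\ r+\alpha-j & \text{otherwise.} \end{cases}$$ In particular, for fixed $r,s,\alpha$, the Waring rank of $F$ does not depend on the coefficients $a,b\in\mathbb{C}\setminus\{0\}$.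 -/

import Mathlib

/-- `F` is a sum `a₁ L₁ ^ d + ⋯ + aₙ Lₙ ^ d` with complex scalars `aᵢ` and linear forms `Lᵢ`
in the polynomial ring `ℂ[x, y]`. -/
def HasWaringDecomposition (d : ℕ) (F : MvPolynomial (Fin 2) ℂ) (n : ℕ) : Prop :=
  ∃ (a : Fin n → ℂ) (L : Fin n → MvPolynomial (Fin 2) ℂ),
    (∀ i, (L i).IsHomogeneous 1) ∧ F = ∑ i, MvPolynomial.C (a i) * L i ^ d

/-- The complex Waring rank of a binary form `F` of degree `d`: the least `n` for which `F` is a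
linear combination of `n` powers `L ^ d` of linear forms (`⊤` if there is no such `n`). -/
noncomputable def waringRank (d : ℕ) (F : MvPolynomial (Fin 2) ℂ) : ℕ∞ :=
  ⨅ (n : ℕ) (_ : HasWaringDecomposition d F n), (n : ℕ∞)

/-- The binomial form `a x^r y^(s+α) + b x^(r+α) y^s`, where `x = X 0` and `y = X 1`. -/
noncomputable def binomialForm (r s α : ℕ) (a b : ℂ) : MvPolynomial (Fin 2) ℂ :=
  MvPolynomial.C a * MvPolynomial.X 0 ^ r * MvPolynomial.X 1 ^ (s + α) +
    MvPolynomial.C b * MvPolynomial.X 0 ^ (r + α) * MvPolynomial.X 1 ^ s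

/-! The proof is Sylvester's apolarity. Dividing the coefficients of a form by binomials gives a
functional `φ` on `ℂ[X]`. A decomposition of length n yields a squarefree binary form of degree m ≤
n, dehomogenized to `g`, with φ(X^i g) = 0 whenever i + m ≤ d (`exists_apolar`). Conversely,
interpolation at the roots of `g` recovers a decomposition (`hasWaringDecomposition_natDegree`, and
`hasWaringDecomposition_natDegree_add_one` when infinity is also a root).

For the binomial, φ(p) = A p_r + B p_(r+α), so apolarity reads A g_u + B g_(u+α) = 0 for m - s - α ≤
u ≤ r, and vanishing propagates along progressions of step α. A squarefree form has no double root
at 0 or infinity, so neither its two lowest nor its two highest coefficients both vanish. When m is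
too small, progressions leaving [0, m] force one of these pairs to vanish (`le_of_recurrence`). The
bound is attained by geometric sums in ρ X^α with ρ = -A/B, adjusted by a root at 0 or infinity, or
by a generic term c X^N. -/

open Polynomial in
/-- The value at `(x, y)` of the homogenization of `f` in degree `D`. -/
noncomputable def homEval (D : ℕ) (f : ℂ[X]) (x y : ℂ) : ℂ :=
  ∑ k ∈ Finset.range (D + 1), f.coeff k * (x ^ k * y ^ (D - k))

/-! ### Binary forms and their coefficients -/

/-- The binary form of degree `d` whose coefficient at `x ^ k y ^ (d - k)` is `c k`. -/
noncomputable def binaryForm (d : ℕ) (c : ℕ → ℂ) : MvPolynomial (Fin 2) ℂ :=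
  ∑ k ∈ Finset.range (d + 1),
    MvPolynomial.C (c k) * (MvPolynomial.X 0 ^ k * MvPolynomial.X 1 ^ (d - k))

theorem coeff_binaryForm (d : ℕ) (c : ℕ → ℂ) {k : ℕ} (hk : k ≤ d) :
    (binaryForm d c).coeff (Finsupp.single 0 k + Finsupp.single 1 (d - k)) = c k := by
  classical
  unfold binaryForm
  rw [MvPolynomial.coeff_sum, Finset.sum_eq_single k]
  · rw [MvPolynomial.coeff_C_mul, MvPolynomial.X_pow_eq_monomial, MvPolynomial.X_pow_eq_monomial,
      MvPolynomial.monomial_mul, MvPolynomial.coeff_monomial, if_pos rfl]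
    simp
  · intro l _ hl
    rw [MvPolynomial.coeff_C_mul, MvPolynomial.X_pow_eq_monomial, MvPolynomial.X_pow_eq_monomial,
      MvPolynomial.monomial_mul, MvPolynomial.coeff_monomial, if_neg, mul_zero]
    intro h
    have := DFunLike.congr_fun h 0
    simp at this
    exact hl this
  · intro h
    exact absurd (Finset.mem_range.2 (Nat.lt_succ_of_le hk)) h

theorem binaryForm_inj (d : ℕ) (c c' : ℕ → ℂ) :
    binaryForm d c = binaryForm d c' ↔ ∀ k ≤ d, c k = c' k := by
  constructor
  · intro h k hk
    rw [← coeff_binaryForm d c hk, h, coeff_binaryForm d c' hk]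
  · intro h
    refine Finset.sum_congr rfl fun k hk => ?_
    rw [h k (Nat.lt_succ_iff.1 (Finset.mem_range.1 hk))]

theorem linearForm_pow (d : ℕ) (x y : ℂ) :
    (MvPolynomial.C x * MvPolynomial.X 0 + MvPolynomial.C y * MvPolynomial.X 1 :
      MvPolynomial (Fin 2) ℂ) ^ d =
      binaryForm d fun k => (d.choose k : ℂ) * (x ^ k * y ^ (d - k)) := by
  rw [add_pow, binaryForm]
  refine Finset.sum_congr rfl fun k _ => ?_
  simp only [map_mul, map_pow, map_natCast]
  ring

theorem sum_C_mul_binaryForm {ι : Type*} (S : Finset ι) (d : ℕ) (a : ι → ℂ) (c : ι → ℕ → ℂ) :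
    ∑ i ∈ S, MvPolynomial.C (a i) * binaryForm d (c i) =
      binaryForm d fun k => ∑ i ∈ S, a i * c i k := by
  simp only [binaryForm, Finset.mul_sum, map_sum, Finset.sum_mul, map_mul]
  rw [Finset.sum_comm]
  refine Finset.sum_congr rfl fun k _ => Finset.sum_congr rfl fun i _ => ?_
  ring

theorem exists_linearForm {L : MvPolynomial (Fin 2) ℂ} (hL : L.IsHomogeneous 1) :
    ∃ x y : ℂ, L = MvPolynomial.C x * MvPolynomial.X 0 + MvPolynomial.C y * MvPolynomial.X 1 := by
  have h := (MvPolynomial.mem_homogeneousSubmodule 1 L).2 hL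
  rw [MvPolynomial.homogeneousSubmodule_one_eq_span_X, Submodule.mem_span_range_iff_exists_fun] at h
  obtain ⟨c, hc⟩ := h
  refine ⟨c 0, c 1, ?_⟩
  rw [← hc, Fin.sum_univ_two, MvPolynomial.smul_eq_C_mul, MvPolynomial.smul_eq_C_mul]

theorem sum_linearForm_pow {ι : Type*} [Fintype ι] (d : ℕ) (a x y : ι → ℂ) :
    ∑ i, MvPolynomial.C (a i) * (MvPolynomial.C (x i) * MvPolynomial.X 0 +
        MvPolynomial.C (y i) * MvPolynomial.X 1 : MvPolynomial (Fin 2) ℂ) ^ d =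
      binaryForm d fun k => (d.choose k : ℂ) * ∑ i, a i * (x i ^ k * y i ^ (d - k)) := by
  simp only [linearForm_pow, sum_C_mul_binaryForm, Finset.mul_sum]
  congr 1
  ext k
  exact Finset.sum_congr rfl fun i _ => by ring

/-- A form has a Waring decomposition of length `n` if and only if its divided coefficients are
a sum of `n` geometric sequences. -/
theorem hasWaringDecomposition_binaryForm_iff (d n : ℕ) (c : ℕ → ℂ) :
    HasWaringDecomposition d (binaryForm d fun k => (d.choose k : ℂ) * c k) n ↔
      ∃ a x y : Fin n → ℂ, ∀ k ≤ d, c k = ∑ i, a i * (x i ^ k * y i ^ (d - k)) := by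
  have key (a x y : Fin n → ℂ) : (binaryForm d fun k => (d.choose k : ℂ) * c k) =
      ∑ i, MvPolynomial.C (a i) * (MvPolynomial.C (x i) * MvPolynomial.X 0 +
        MvPolynomial.C (y i) * MvPolynomial.X 1 : MvPolynomial (Fin 2) ℂ) ^ d ↔
      ∀ k ≤ d, c k = ∑ i, a i * (x i ^ k * y i ^ (d - k)) := by
    rw [sum_linearForm_pow, binaryForm_inj]
    refine forall₂_congr fun k hk => ?_
    exact mul_right_inj' (Nat.cast_ne_zero.2 (Nat.choose_pos hk).ne')
  constructor
  · rintro ⟨a, L, hL, hF⟩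
    choose x y hxy using fun i => exists_linearForm (hL i)
    refine ⟨a, x, y, (key a x y).1 ?_⟩
    rw [hF]
    exact Finset.sum_congr rfl fun i _ => by rw [hxy i]
  · rintro ⟨a, x, y, h⟩
    refine ⟨a, fun i => MvPolynomial.C (x i) * MvPolynomial.X 0 +
      MvPolynomial.C (y i) * MvPolynomial.X 1, fun i => ?_, (key a x y).2 h⟩
    exact (MvPolynomial.isHomogeneous_C_mul_X _ _).add (MvPolynomial.isHomogeneous_C_mul_X _ _)

theorem hasWaringDecomposition_of_fintype {ι : Type*} [Fintype ι] (d : ℕ) (c : ℕ → ℂ)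
    (a x y : ι → ℂ) (h : ∀ k ≤ d, c k = ∑ i, a i * (x i ^ k * y i ^ (d - k))) :
    HasWaringDecomposition d (binaryForm d fun k => (d.choose k : ℂ) * c k)
      (Fintype.card ι) := by
  rw [hasWaringDecomposition_binaryForm_iff]
  let e := (Fintype.equivFin ι).symm
  refine ⟨a ∘ e, x ∘ e, y ∘ e, fun k hk => ?_⟩
  rw [h k hk]
  exact (e.sum_comp fun i => a i * (x i ^ k * y i ^ (d - k))).symm

/-! ### Apolarity: decompositions and annihilating polynomials -/

section Apolarity

open Polynomial

theorem homEval_of_ne_zero {D : ℕ} {f : ℂ[X]} (hf : f.natDegree ≤ D) (x : ℂ) {y : ℂ}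
    (hy : y ≠ 0) : homEval D f x y = y ^ D * f.eval (x / y) := by
  rw [homEval, eval_eq_sum_range' (Nat.lt_succ_of_le hf), Finset.mul_sum]
  refine Finset.sum_congr rfl fun k hk => ?_
  have hk' : k ≤ D := Nat.lt_succ_iff.1 (Finset.mem_range.1 hk)
  rw [div_pow]
  nth_rewrite 2 [← Nat.sub_add_cancel hk']
  rw [pow_add]
  field_simp

theorem homEval_zero (D : ℕ) (f : ℂ[X]) (x : ℂ) :
    homEval D f x 0 = f.coeff D * x ^ D := by
  rw [homEval, Finset.sum_range_succ, Finset.sum_eq_zero]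
  · simp
  · intro k hk
    rw [zero_pow (Nat.sub_ne_zero_of_lt (Finset.mem_range.1 hk))]
    simp

theorem map_eq_sum_homEval {ι : Type*} [Fintype ι] {d : ℕ} (φ : ℂ[X] →ₗ[ℂ] ℂ) (a x y : ι → ℂ)
    (h : ∀ k ≤ d, φ (X ^ k) = ∑ i, a i * (x i ^ k * y i ^ (d - k))) {f : ℂ[X]}
    (hf : f.natDegree ≤ d) : φ f = ∑ i, a i * homEval d f (x i) (y i) := by
  conv_lhs => rw [f.as_sum_range_C_mul_X_pow' (Nat.lt_succ_of_le hf)]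
  simp only [homEval, Finset.mul_sum]
  rw [map_sum, Finset.sum_comm]
  refine Finset.sum_congr rfl fun k hk => ?_
  rw [← smul_eq_C_mul, map_smul, h k (Nat.lt_succ_iff.1 (Finset.mem_range.1 hk)), smul_eq_mul,
    Finset.mul_sum]
  exact Finset.sum_congr rfl fun i _ => by ring

theorem coeff_zero_ne_or_coeff_one_ne {g : ℂ[X]} (hg : Squarefree g) :
    g.coeff 0 ≠ 0 ∨ g.coeff 1 ≠ 0 := by
  by_contra! h
  have hX : X ^ 2 ∣ g := X_pow_dvd_iff.2 fun k hk => by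
    interval_cases k
    · exact h.1
    · exact h.2
  rw [pow_two] at hX
  exact not_isUnit_X (hg X hX)

/-- The points of a decomposition of length `n` are the zeros of an apolar form without multiple
factors, here dehomogenized. -/
theorem exists_apolar {ι : Type*} [Fintype ι] {d : ℕ} (φ : ℂ[X] →ₗ[ℂ] ℂ) (a x y : ι → ℂ)
    (h : ∀ k ≤ d, φ (X ^ k) = ∑ i, a i * (x i ^ k * y i ^ (d - k))) :
    ∃ (g : ℂ[X]) (m : ℕ), m ≤ Fintype.card ι ∧ Squarefree g ∧ g.natDegree ≤ m ∧
      m ≤ g.natDegree + 1 ∧ ∀ i, i + m ≤ d → φ (X ^ i * g) = 0 := by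
  classical
  let T : Finset ℂ := (Finset.univ.filter fun i => y i ≠ 0).image fun i => x i / y i
  let E : Finset ι := Finset.univ.filter fun i => ¬ y i ≠ 0
  let g : ℂ[X] := ∏ z ∈ T, (X - C z)
  have hdeg : g.natDegree = T.card := natDegree_finsetProd_X_sub_C_eq_card T id
  have hT : T.card + E.card ≤ Fintype.card ι := by
    have h1 : T.card ≤ _ := Finset.card_image_le
    have h2 := Finset.card_filter_add_card_filter_not (s := (Finset.univ : Finset ι))
      (fun i => y i ≠ 0)
    rw [Finset.card_univ] at h2
    change _ + E.card = _ at h2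
    omega
  -- All points with `y = 0` are the same point at infinity, counted once; it adds to the degree of
  -- the form but not to that of `g`.
  refine ⟨g, T.card + min E.card 1, ?_, ?_, ?_, ?_, ?_⟩
  · have := min_le_left E.card 1
    omega
  · exact (separable_prod_X_sub_C_iff' (f := fun z : ℂ => z)).2
      (fun _ _ _ _ hxy => hxy) |>.squarefree
  · omega
  · omega
  · intro i hi
    have hle : (X ^ i * g).natDegree ≤ i + T.card := by
      refine natDegree_mul_le.trans ?_
      rw [hdeg, natDegree_X_pow]
    rw [map_eq_sum_homEval φ a x y h (by omega)]
    refine Finset.sum_eq_zero fun l _ => ?_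
    by_cases hl : y l = 0
    · have hE : 0 < E.card := Finset.card_pos.2 ⟨l, by simp [E, hl]⟩
      rw [hl, homEval_zero, coeff_eq_zero_of_natDegree_lt (by omega)]
      simp
    · have hmem : x l / y l ∈ T := Finset.mem_image_of_mem _ (by simp [hl])
      rw [homEval_of_ne_zero (by omega) _ hl, eval_mul, eval_prod,
        Finset.prod_eq_zero hmem (by simp)]
      simp

theorem map_mul_eq_zero_of_natDegree_le (φ : ℂ[X] →ₗ[ℂ] ℂ) {g : ℂ[X]} {N : ℕ}
    (h : ∀ i ≤ N, φ (X ^ i * g) = 0) {f : ℂ[X]} (hf : f.natDegree ≤ N) : φ (f * g) = 0 := by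
  rw [f.as_sum_range_C_mul_X_pow' (Nat.lt_succ_of_le hf), Finset.sum_mul, map_sum]
  refine Finset.sum_eq_zero fun i hi => ?_
  rw [mul_assoc, ← smul_eq_C_mul, map_smul, h i (Nat.lt_succ_iff.1 (Finset.mem_range.1 hi)),
    smul_zero]

/-- A functional killing the multiples of a separable `g` up to degree `D` is a combination of
evaluations at the roots of `g`. -/
theorem exists_eq_sum_roots (φ : ℂ[X] →ₗ[ℂ] ℂ) {g : ℂ[X]} (hg : g.Separable) {D : ℕ}
    (h : ∀ i, i + g.natDegree ≤ D → φ (X ^ i * g) = 0) :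
    ∃ (T : Finset ℂ) (a : T → ℂ), T.card = g.natDegree ∧
      ∀ k ≤ D, φ (X ^ k) = ∑ z : T, a z * (z : ℂ) ^ k := by
  classical
  have hg0 : g ≠ 0 := hg.ne_zero
  have hcard : g.roots.toFinset.card = g.natDegree := by
    rw [Multiset.toFinset_card_of_nodup (nodup_roots hg)]
    exact (IsAlgClosed.splits g).natDegree_eq_card_roots.symm
  refine ⟨g.roots.toFinset, fun z => φ (Lagrange.basis g.roots.toFinset id z), hcard, ?_⟩
  intro k hk
  -- `φ` sees `X ^ k` only modulo `g`, and the remainder is the Lagrange interpolant of `z ^ k` at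
  -- the roots.
  have hdeg : (X ^ k % g : ℂ[X]).degree < g.roots.toFinset.card := by
    rw [hcard, ← degree_eq_natDegree hg0]
    exact EuclideanDomain.mod_lt _ hg0
  have heval : ∀ z ∈ g.roots.toFinset, (X ^ k % g : ℂ[X]).eval z = z ^ k := by
    intro z hz
    have hz0 : g.eval z = 0 := (mem_roots hg0).1 (Multiset.mem_toFinset.1 hz)
    have := congrArg (eval z) (EuclideanDomain.div_add_mod (X ^ k : ℂ[X]) g)
    simpa [hz0] using this
  have hint := Lagrange.eq_interpolate_of_eval_eq (s := g.roots.toFinset) (v := id)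
    (fun z => z ^ k) (Function.injective_id.injOn) hdeg heval
  have hdiv : φ ((X ^ k / g : ℂ[X]) * g) = 0 := by
    by_cases hlt : k < g.natDegree
    · rw [Polynomial.div_eq_zero_iff hg0 |>.2]
      · simp
      · rw [degree_X_pow, degree_eq_natDegree hg0]
        exact_mod_cast hlt
    · refine map_mul_eq_zero_of_natDegree_le φ (N := k - g.natDegree)
        (fun i hi => h i (by omega)) ?_
      have hle : g.degree ≤ (X ^ k : ℂ[X]).degree := by
        rw [degree_X_pow, degree_eq_natDegree hg0]
        exact_mod_cast not_lt.1 hlt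
      have h0 : (X ^ k / g : ℂ[X]) ≠ 0 :=
        fun h0 => not_lt.2 hle ((Polynomial.div_eq_zero_iff hg0).1 h0)
      have hadd := degree_add_div hg0 hle
      rw [degree_X_pow, degree_eq_natDegree hg0, degree_eq_natDegree h0] at hadd
      norm_cast at hadd
      omega
  rw [← EuclideanDomain.div_add_mod (X ^ k : ℂ[X]) g, mul_comm, map_add, hdiv, zero_add, hint,
    Lagrange.interpolate_apply, map_sum, ← Finset.sum_coe_sort]
  refine Finset.sum_congr rfl fun z _ => ?_
  rw [← smul_eq_C_mul, map_smul, smul_eq_mul, mul_comm]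

theorem hasWaringDecomposition_natDegree (φ : ℂ[X] →ₗ[ℂ] ℂ) {g : ℂ[X]} (hg : g.Separable) {d : ℕ}
    (h : ∀ i, i + g.natDegree ≤ d → φ (X ^ i * g) = 0) :
    HasWaringDecomposition d (binaryForm d fun k => (d.choose k : ℂ) * φ (X ^ k))
      g.natDegree := by
  obtain ⟨T, a, hT, ha⟩ := exists_eq_sum_roots φ hg h
  rw [← hT, ← Fintype.card_coe]
  refine hasWaringDecomposition_of_fintype d _ a (fun z => z) (fun _ => 1) fun k hk => ?_
  simpa using ha k hk

/-- The extra point (1, 0) contributes 1^k 0^(d-k), nonzero only at k = d. The roots of `g`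
therefore need to match only the terms below d, and the new weight corrects the last one. -/
theorem hasWaringDecomposition_natDegree_add_one (φ : ℂ[X] →ₗ[ℂ] ℂ) {g : ℂ[X]}
    (hg : g.Separable) {d : ℕ} (h : ∀ i, i + (g.natDegree + 1) ≤ d → φ (X ^ i * g) = 0) :
    HasWaringDecomposition d (binaryForm d fun k => (d.choose k : ℂ) * φ (X ^ k))
      (g.natDegree + 1) := by
  rcases Nat.eq_zero_or_pos d with rfl | hd
  · have : Fintype.card (Fin (g.natDegree + 1)) = g.natDegree + 1 := Fintype.card_fin _
    rw [← this]
    -- In degree 0 the zero linear form suffices, since 0^0 = 1.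
    refine hasWaringDecomposition_of_fintype 0 _ (Pi.single 0 (φ 1)) 0 0 fun k hk => ?_
    obtain rfl : k = 0 := by omega
    simp
  · obtain ⟨T, a, hT, ha⟩ := exists_eq_sum_roots φ hg (D := d - 1) fun i hi => h i (by omega)
    rw [← hT, ← Fintype.card_coe, ← Fintype.card_option]
    refine hasWaringDecomposition_of_fintype d _
      (fun z => z.elim (φ (X ^ d) - ∑ z : T, a z * (z : ℂ) ^ d) a)
      (fun z => z.elim 1 fun w => w) (fun z => z.elim 0 fun _ => 1) fun k hk => ?_
    rw [Fintype.sum_option]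
    rcases hk.eq_or_lt with rfl | hk
    · simp
    · rw [ha k (by omega)]
      simp [zero_pow (Nat.sub_ne_zero_of_lt hk)]

end Apolarity

/-! ### Separability of geometric sums and of pencils -/

section Geometric

open Polynomial

/-- The geometric sum `1 + ρ X ^ α + ⋯ + (ρ X ^ α) ^ n`. -/
noncomputable def geomPoly (ρ : ℂ) (α n : ℕ) : ℂ[X] :=
  ∑ k ∈ Finset.range (n + 1), (C ρ * X ^ α) ^ k

theorem geomPoly_mul (ρ : ℂ) (α n : ℕ) :
    geomPoly ρ α n * (C ρ * X ^ α - 1) = C (ρ ^ (n + 1)) * X ^ (α * (n + 1)) - 1 := by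
  rw [geomPoly, geom_sum_mul, mul_pow, ← pow_mul, C_pow]

theorem eval_zero_geomPoly (ρ : ℂ) {α : ℕ} (hα : α ≠ 0) (n : ℕ) :
    (geomPoly ρ α n).eval 0 = 1 := by
  simp [geomPoly, eval_finsetSum, hα, Finset.sum_range_succ']

theorem natDegree_geomPoly {ρ : ℂ} (hρ : ρ ≠ 0) {α : ℕ} (hα : α ≠ 0) (n : ℕ) :
    (geomPoly ρ α n).natDegree = α * n := by
  have h1 : (C ρ * X ^ α - 1 : ℂ[X]).natDegree = α := by
    rw [← C_1, natDegree_sub_C, natDegree_C_mul_X_pow _ _ hρ]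
  have h2 : (C (ρ ^ (n + 1)) * X ^ (α * (n + 1)) - 1 : ℂ[X]).natDegree = α * (n + 1) := by
    rw [← C_1, natDegree_sub_C, natDegree_C_mul_X_pow _ _ (pow_ne_zero _ hρ)]
  have hne : geomPoly ρ α n ≠ 0 := by
    intro h
    simpa [h] using eval_zero_geomPoly ρ hα n
  have hne' : (C ρ * X ^ α - 1 : ℂ[X]) ≠ 0 := by
    intro h
    rw [h, natDegree_zero] at h1
    exact hα h1.symm
  have := congrArg natDegree (geomPoly_mul ρ α n)
  rw [natDegree_mul hne hne', h1, h2, mul_add, mul_one] at this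
  omega

theorem separable_C_mul_X_pow_sub_one {c : ℂ} (hc : c ≠ 0) {N : ℕ} (hN : N ≠ 0) :
    (C c * X ^ N - 1 : ℂ[X]).Separable := by
  have h : (C c * X ^ N - 1 : ℂ[X]) = C c * (X ^ N - C c⁻¹) := by
    rw [mul_sub, ← C_mul, mul_inv_cancel₀ hc, C_1]
  rw [h]
  exact (separable_X_pow_sub_C _ (Nat.cast_ne_zero.2 hN) (inv_ne_zero hc)).unit_mul
    (isUnit_C.2 hc.isUnit)

theorem separable_geomPoly {ρ : ℂ} (hρ : ρ ≠ 0) {α : ℕ} (hα : α ≠ 0) (n : ℕ) :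
    (geomPoly ρ α n).Separable := by
  have h := separable_C_mul_X_pow_sub_one (pow_ne_zero (n + 1) hρ)
    (mul_ne_zero hα n.succ_ne_zero)
  rw [← geomPoly_mul] at h
  exact h.of_mul_left

theorem separable_X_mul {f : ℂ[X]} (hf : f.Separable) (h0 : f.eval 0 ≠ 0) :
    (X * f).Separable := by
  refine separable_X.mul hf ?_
  rw [irreducible_X.coprime_iff_not_dvd, X_dvd_iff, coeff_zero_eq_eval_zero]
  exact h0

theorem separable_of_eval_derivative {f : ℂ[X]}
    (h : ∀ z, f.eval z = 0 → (derivative f).eval z ≠ 0) : f.Separable := by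
  rw [separable_def]
  refine isCoprime_of_dvd _ _ ?_ ?_
  · rintro ⟨rfl, _⟩
    exact h 0 (by simp) (by simp)
  · intro p hp hp0 h1 h2
    obtain ⟨z, hz⟩ := IsAlgClosed.exists_root p (fun hd => hp (isUnit_iff_degree_eq_zero.2 hd))
    exact h z (hz.dvd h1) (hz.dvd h2)

/-- A general member of the pencil spanned by `P` and `X ^ N` is separable. -/
theorem exists_separable_add_X_pow {P : ℂ[X]} (hP : P.eval 0 ≠ 0) {N : ℕ} (hN : N ≠ 0) :
    ∃ c : ℂ, c ≠ 0 ∧ (P + C c * X ^ N).Separable := by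
  classical
  -- Eliminating c between P + c X^N and its derivative shows that a multiple root is a root of `W`,
  -- so only finitely many c are bad.
  let W : ℂ[X] := X * derivative P - C (N : ℂ) * P
  have hW : W ≠ 0 := by
    intro h
    have := congrArg (eval 0) h
    simp [W, hN, hP] at this
  obtain ⟨c, hc⟩ := Infinite.exists_notMem_finset
    (insert 0 (W.roots.toFinset.image fun z => -P.eval z / z ^ N))
  rw [Finset.mem_insert, not_or] at hc
  refine ⟨c, hc.1, separable_of_eval_derivative fun z hz hz' => hc.2 ?_⟩
  have hz0 : z ≠ 0 := by
    rintro rfl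
    simp [hN, hP] at hz
  simp only [eval_add, eval_mul, eval_C, eval_pow, eval_X] at hz
  simp only [derivative_add, derivative_C_mul_X_pow, eval_add, eval_mul, eval_C, eval_pow,
    eval_X] at hz'
  refine Finset.mem_image.2 ⟨z, ?_, ?_⟩
  · rw [Multiset.mem_toFinset, mem_roots hW, IsRoot.def]
    simp only [W, eval_sub, eval_mul, eval_C, eval_X]
    obtain ⟨M, rfl⟩ := Nat.exists_eq_succ_of_ne_zero hN
    simp only [Nat.succ_eq_add_one, Nat.add_sub_cancel] at hz' hz ⊢
    linear_combination z * hz' - ((M + 1 : ℕ) : ℂ) * hz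
  · rw [div_eq_iff (pow_ne_zero _ hz0)]
    linear_combination -hz

end Geometric

/-! ### The functional of the binomial -/

section TwoTerm

open Polynomial

/-- The functional `p ↦ A p_r + B p_(r + α)`, where `p_k` is the coefficient at `X ^ k`. -/
noncomputable def twoTerm (r α : ℕ) (A B : ℂ) : ℂ[X] →ₗ[ℂ] ℂ :=
  A • lcoeff ℂ r + B • lcoeff ℂ (r + α)

theorem twoTerm_apply (r α : ℕ) (A B : ℂ) (p : ℂ[X]) :
    twoTerm r α A B p = A * p.coeff r + B * p.coeff (r + α) := rfl

theorem binomialForm_eq_binaryForm (r s : ℕ) {α : ℕ} (hα : α ≠ 0) (a b : ℂ) :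
    binomialForm r s α a b = binaryForm (r + s + α) fun k => ((r + s + α).choose k : ℂ) *
      twoTerm r α (a / (r + s + α).choose r) (b / (r + s + α).choose (r + α)) (X ^ k) := by
  have h1 : ((r + s + α).choose r : ℂ) ≠ 0 :=
    Nat.cast_ne_zero.2 (Nat.choose_pos (by omega)).ne'
  have h2 : ((r + s + α).choose (r + α) : ℂ) ≠ 0 :=
    Nat.cast_ne_zero.2 (Nat.choose_pos (by omega)).ne'
  rw [binaryForm, Finset.sum_eq_add_of_mem r (r + α) (by simp; omega) (by simp) (by omega)]
  · rw [twoTerm_apply, twoTerm_apply]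
    simp only [coeff_X_pow, if_true]
    rw [if_neg (by omega), if_neg (by omega), binomialForm]
    rw [show r + s + α - r = s + α by omega, show r + s + α - (r + α) = s by omega]
    simp only [mul_one, mul_zero, add_zero, zero_add]
    rw [mul_div_cancel₀ _ h1, mul_div_cancel₀ _ h2]
    ring
  · rintro k - ⟨hk1, hk2⟩
    rw [twoTerm_apply, coeff_X_pow, coeff_X_pow, if_neg (Ne.symm hk1), if_neg (Ne.symm hk2)]
    simp

/-- Multiply the telescoping identity `geomPoly_mul` by `X ^ i` and compare coefficients at r + α:
the two hypotheses keep both monomials on the right away from that degree. -/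
theorem twoTerm_X_pow_mul_geomPoly {A B : ℂ} (hB : B ≠ 0) {r α i n : ℕ}
    (h1 : i ≠ r + α) (h2 : r + α < i + α * (n + 1)) :
    twoTerm r α A B (X ^ i * geomPoly (-A / B) α n) = 0 := by
  have h : (X ^ i * _ : ℂ[X]).coeff (r + α) = (X ^ i * _ : ℂ[X]).coeff (r + α) :=
    congrArg (fun p => (X ^ i * p).coeff (r + α)) (geomPoly_mul (-A / B) α n)
  have e1 : X ^ i * (geomPoly (-A / B) α n * (C (-A / B) * X ^ α - 1)) =
      C (-A / B) * (X ^ i * geomPoly (-A / B) α n) * X ^ α -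
        X ^ i * geomPoly (-A / B) α n := by ring
  have e2 : (X ^ i * (C ((-A / B) ^ (n + 1)) * X ^ (α * (n + 1)) - 1) : ℂ[X]) =
      C ((-A / B) ^ (n + 1)) * X ^ (i + α * (n + 1)) - X ^ i := by ring
  rw [e1, e2, coeff_sub, coeff_sub, coeff_mul_X_pow, coeff_C_mul, coeff_C_mul_X_pow,
    if_neg (by omega), coeff_X_pow, if_neg (Ne.symm h1)] at h
  rw [twoTerm_apply]
  generalize geomPoly (-A / B) α n = Q at h ⊢
  field_simp at h
  linear_combination -h

theorem twoTerm_X_pow_mul_of_lt (A B c : ℂ) {r α N : ℕ} (hN : r + α < N) (i : ℕ) :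
    twoTerm r α A B (X ^ i * (C c * X ^ N)) = 0 := by
  have e : (X ^ i * (C c * X ^ N) : ℂ[X]) = C c * X ^ (i + N) := by ring
  rw [twoTerm_apply, e, coeff_C_mul_X_pow, coeff_C_mul_X_pow, if_neg (by omega),
    if_neg (by omega)]
  simp

/-- The coefficients of `g`, extended by zero to negative indices. -/
noncomputable def intCoeff (g : ℂ[X]) (u : ℤ) : ℂ := if u < 0 then 0 else g.coeff u.toNat

theorem intCoeff_natCast (g : ℂ[X]) (k : ℕ) : intCoeff g k = g.coeff k := by
  simp [intCoeff]

theorem coeff_X_pow_mul_eq_intCoeff (g : ℂ[X]) (i k : ℕ) :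
    (X ^ i * g).coeff k = intCoeff g (k - i) := by
  rw [coeff_X_pow_mul', intCoeff]
  split_ifs with h1 h2 h2
  · omega
  · congr 1
    omega
  · rfl
  · omega

theorem intCoeff_eq_zero_of_neg (g : ℂ[X]) {u : ℤ} (hu : u < 0) : intCoeff g u = 0 :=
  if_pos hu

theorem intCoeff_eq_zero_of_gt (g : ℂ[X]) {u : ℤ} (hu : (g.natDegree : ℤ) < u) :
    intCoeff g u = 0 := by
  rw [intCoeff]
  split_ifs
  · rfl
  · exact coeff_eq_zero_of_natDegree_lt (by omega)

end TwoTerm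

/-! ### Lower bound -/

/-- Zeros propagate along arithmetic progressions. -/
theorem eq_zero_iff_add_mul {G : ℤ → ℂ} {lo hi : ℤ} {α : ℕ}
    (h : ∀ u, lo ≤ u → u ≤ hi → (G u = 0 ↔ G (u + α) = 0)) (k : ℕ) (u : ℤ) (hu : lo ≤ u)
    (hk : u + k * α ≤ hi + α) : G u = 0 ↔ G (u + k * α) = 0 := by
  induction k with
  | zero => simp
  | succ k ih =>
    have hα : (0 : ℤ) ≤ k * α := by positivity
    have e : u + ((k + 1 : ℕ) : ℤ) * α = u + k * α + α := by push_cast; ring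
    rw [e] at hk ⊢
    rw [ih (by linarith [Int.natCast_nonneg α]), h _ (by linarith) (by linarith)]

/-- The combinatorial lower bound: a sequence supported on `[0, m]` with the recurrence of an
apolar form of degree `m` has to vanish at one of the ends when `m` is small. -/
theorem le_of_recurrence {r s α q j m : ℕ} (hrs : r ≤ s) (hα : 1 ≤ α)
    (hr : r = q * α + j) (hj : j < α) {G : ℤ → ℂ}
    (h : ∀ u : ℤ, (m : ℤ) - s - α ≤ u → u ≤ r → (G u = 0 ↔ G (u + α) = 0))
    (hneg : ∀ u : ℤ, u < 0 → G u = 0) (hgt : ∀ u : ℤ, (m : ℤ) < u → G u = 0)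
    (h01 : G 0 ≠ 0 ∨ G 1 ≠ 0) (hm : G m ≠ 0 ∨ G (m - 1) ≠ 0) :
    (if r + α ≤ s then s + 1
      else if j = 0 ∧ r = s ∧ 1 < α then s + 2
      else if j + s = r + α then s + 1
      else if r + α < j + s then r + α + 1
      else r + α - j) ≤ m := by
  have prop := eq_zero_iff_add_mul h
  have hqα : ((q + 1 : ℕ) : ℤ) * α = q * α + α := by push_cast; ring
  have hrZ : (r : ℤ) = q * α + j := by exact_mod_cast hr
  -- an index whose progression starts at a negative position of the range
  have low : ∀ (k : ℕ) (u : ℤ), u < 0 → (m : ℤ) - s - α ≤ u → u + k * α ≤ r + α →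
      G (u + k * α) = 0 := fun k u hu h1 h2 => (prop k u h1 h2).1 (hneg u hu)
  -- If m ≤ s, the recurrence starts at or below -α, so 0 and 1 are both reached from negative
  -- indices; for α = 1, index 1 takes two steps from -1.
  have hs : s < m := by
    by_contra! hle
    have h0 : G 0 = 0 := by
      have := low 1 (-α) (by omega) (by omega) (by push_cast; omega)
      simpa using this
    have h1 : G 1 = 0 := by
      rcases hα.eq_or_lt with rfl | hα
      · have := low 2 (-1) (by omega) (by omega) (by push_cast; omega)
        simpa using this
      · have := low 1 (1 - α) (by omega) (by omega) (by push_cast; omega)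
        simpa using this
    exact h01.elim (fun h => h h0) (fun h => h h1)
  split_ifs with c1 c2 c3 c4
  · exact hs
  · obtain ⟨rfl, rfl, hα1⟩ := c2
    by_contra! hlt
    -- Index 0 climbs to (q + 1)α = r + α > m, while index 1 descends to 1 - α < 0.
    have hm1 : m = r + 1 := by omega
    have h0 : G 0 = 0 := by
      refine (prop (q + 1) 0 (by omega) (by rw [hqα]; omega)).2 (hgt _ ?_)
      rw [hqα]; omega
    have h1 : G 1 = 0 := by
      have := low 1 (1 - α) (by omega) (by omega) (by push_cast; omega)
      simpa using this
    exact h01.elim (fun h => h h0) (fun h => h h1)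
  · exact hs
  · by_contra! hlt
    have hq2 : ((q + 2 : ℕ) : ℤ) * α = q * α + 2 * α := by push_cast; ring
    -- Both top indices descend below 0 in q + 2 steps; j > δ keeps the starting points in range.
    have key : ∀ u : ℤ, (m : ℤ) - 1 ≤ u → u ≤ m → G u = 0 := by
      intro u h1 h2
      have := low (q + 2) (u - (q + 2 : ℕ) * α) (by rw [hq2]; omega) (by rw [hq2]; omega)
        (by rw [hq2]; omega)
      simpa using this
    exact hm.elim (fun h => h (key _ (by omega) le_rfl)) (fun h => h (key _ le_rfl (by omega)))
  · by_contra! hlt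
    have h0 : G 0 = 0 := by
      refine (prop (q + 1) 0 (by omega) (by rw [hqα]; omega)).2 (hgt _ ?_)
      rw [hqα]; omega
    rcases Nat.eq_zero_or_pos j with rfl | hj0
    · have hrs' : r < s := by omega
      have key : ∀ u : ℤ, (m : ℤ) - 1 ≤ u → u ≤ m → G u = 0 := by
        intro u h1 h2
        have := low (q + 1) (u - (q + 1 : ℕ) * α) (by rw [hqα]; omega) (by rw [hqα]; omega)
          (by rw [hqα]; omega)
        simpa using this
      exact hm.elim (fun h => h (key _ (by omega) le_rfl))
        (fun h => h (key _ le_rfl (by omega)))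
    · have h1 : G 1 = 0 := by
        refine (prop (q + 1) 1 (by omega) (by rw [hqα]; omega)).2 (hgt _ ?_)
        rw [hqα]; omega
      exact h01.elim (fun h => h h0) (fun h => h h1)

open Polynomial in
theorem le_of_hasWaringDecomposition {r s α q j n : ℕ} (hrs : r ≤ s) (hα : 1 ≤ α)
    (hr : r = q * α + j) (hj : j < α) {a b : ℂ} (ha : a ≠ 0) (hb : b ≠ 0)
    (hn : HasWaringDecomposition (r + s + α) (binomialForm r s α a b) n) :
    (if r + α ≤ s then s + 1
      else if j = 0 ∧ r = s ∧ 1 < α then s + 2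
      else if j + s = r + α then s + 1
      else if r + α < j + s then r + α + 1
      else r + α - j) ≤ n := by
  rw [binomialForm_eq_binaryForm r s (by omega), hasWaringDecomposition_binaryForm_iff] at hn
  obtain ⟨w, x, y, hw⟩ := hn
  obtain ⟨g, m, hmn, hg, hgm, hmg, hφ⟩ := exists_apolar _ w x y hw
  rw [Fintype.card_fin] at hmn
  refine le_trans ?_ hmn
  have hA : a / ((r + s + α).choose r : ℂ) ≠ 0 :=
    div_ne_zero ha (Nat.cast_ne_zero.2 (Nat.choose_pos (by omega)).ne')
  have hB : b / ((r + s + α).choose (r + α) : ℂ) ≠ 0 :=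
    div_ne_zero hb (Nat.cast_ne_zero.2 (Nat.choose_pos (by omega)).ne')
  have hlead : intCoeff g g.natDegree ≠ 0 := by
    rw [intCoeff_natCast]
    exact leadingCoeff_ne_zero.2 hg.ne_zero
  refine le_of_recurrence hrs hα hr hj (G := intCoeff g) ?_
    (fun u hu => intCoeff_eq_zero_of_neg g hu)
    (fun u hu => intCoeff_eq_zero_of_gt g (by omega)) ?_ ?_
  · intro u h1 h2
    -- The shift i = r - u places g_u and g_(u+α) under the two terms of the functional.
    have h := hφ (r - u).toNat (by omega)
    rw [twoTerm_apply, coeff_X_pow_mul_eq_intCoeff, coeff_X_pow_mul_eq_intCoeff] at h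
    rw [show (r : ℤ) - (r - u).toNat = u by omega,
      show ((r + α : ℕ) : ℤ) - (r - u).toNat = u + α by omega] at h
    constructor
    · intro h0
      simpa [h0, hB] using h
    · intro h0
      simpa [h0, hA] using h
  · exact coeff_zero_ne_or_coeff_one_ne hg
  · rcases hgm.eq_or_lt with h | h
    · exact Or.inl (h ▸ hlead)
    · refine Or.inr ?_
      rwa [show (m : ℤ) - 1 = g.natDegree by omega]

/-! ### Upper bound -/

open Polynomial in
/-- A general member of a pencil spanned by a geometric sum and `X ^ N` is apolar. -/
theorem hasWaringDecomposition_pencil {r s α q N : ℕ} (hα : 1 ≤ α) (hq : r < (q + 1) * α)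
    (hqN : (q + 1) * α < N) (hN : r + α < N) (hs : s < N) {A B : ℂ} (hA : A ≠ 0) (hB : B ≠ 0) :
    HasWaringDecomposition (r + s + α) (binaryForm (r + s + α) fun k =>
      ((r + s + α).choose k : ℂ) * twoTerm r α A B (X ^ k)) N := by
  have hρ : -A / B ≠ 0 := div_ne_zero (neg_ne_zero.2 hA) hB
  have hP : (geomPoly (-A / B) α (q + 1)).eval 0 ≠ 0 := by
    rw [eval_zero_geomPoly _ (by omega)]
    exact one_ne_zero
  obtain ⟨c, hc, hsep⟩ := exists_separable_add_X_pow hP (N := N) (by omega)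
  have hdeg : (geomPoly (-A / B) α (q + 1) + C c * X ^ N).natDegree = N := by
    rw [natDegree_add_eq_right_of_natDegree_lt] <;> rw [natDegree_C_mul_X_pow _ _ hc]
    rw [natDegree_geomPoly hρ (by omega)]
    linarith
  have h := hasWaringDecomposition_natDegree (twoTerm r α A B) hsep (d := r + s + α) ?_
  · rwa [hdeg] at h
  · intro i hi
    rw [hdeg] at hi
    rw [mul_add, map_add, twoTerm_X_pow_mul_of_lt _ _ _ hN, add_zero]
    exact twoTerm_X_pow_mul_geomPoly hB (by omega) (by linarith [Nat.zero_le i])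

open Polynomial in
theorem hasWaringDecomposition_binomialForm {r s α q j : ℕ} (hrs : r ≤ s) (hα : 1 ≤ α)
    (hr : r = q * α + j) (hj : j < α) {a b : ℂ} (ha : a ≠ 0) (hb : b ≠ 0) :
    HasWaringDecomposition (r + s + α) (binomialForm r s α a b)
      (if r + α ≤ s then s + 1
      else if j = 0 ∧ r = s ∧ 1 < α then s + 2
      else if j + s = r + α then s + 1
      else if r + α < j + s then r + α + 1
      else r + α - j) := by
  rw [binomialForm_eq_binaryForm r s (by omega)]
  have hA : a / ((r + s + α).choose r : ℂ) ≠ 0 :=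
    div_ne_zero ha (Nat.cast_ne_zero.2 (Nat.choose_pos (by omega)).ne')
  have hB : b / ((r + s + α).choose (r + α) : ℂ) ≠ 0 :=
    div_ne_zero hb (Nat.cast_ne_zero.2 (Nat.choose_pos (by omega)).ne')
  generalize a / ((r + s + α).choose r : ℂ) = A at hA
  generalize b / ((r + s + α).choose (r + α) : ℂ) = B at hB
  have hρ : -A / B ≠ 0 := div_ne_zero (neg_ne_zero.2 hA) hB
  have hα0 : α ≠ 0 := by omega
  have e1 : (q + 1) * α = q * α + α := by ring
  have e2 : α * (q + 1) = q * α + α := by ring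
  have e3 : α * q = q * α := by ring
  have e4 : α * (q + 1 + 1) = q * α + α + α := by ring
  split_ifs with c1 c2 c3 c4
  · exact hasWaringDecomposition_pencil (q := q) hα (by omega) (by omega) (by omega) (by omega)
      hA hB
  · obtain ⟨rfl, rfl, hα1⟩ := c2
    -- The root at 0 lets the telescoping clear r + α already at i = 0; the root at infinity removes
    -- the one bad shift i + 1 = r + α.
    have hne : geomPoly (-A / B) α q ≠ 0 := (separable_geomPoly hρ hα0 q).ne_zero
    have hdeg : (X * geomPoly (-A / B) α q).natDegree = r + 1 := by
      rw [natDegree_X_mul hne, natDegree_geomPoly hρ hα0, e3]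
      omega
    have hsep : (X * geomPoly (-A / B) α q).Separable := by
      refine separable_X_mul (separable_geomPoly hρ hα0 q) ?_
      rw [eval_zero_geomPoly _ hα0]
      exact one_ne_zero
    have h := hasWaringDecomposition_natDegree_add_one (twoTerm r α A B) hsep
      (d := r + r + α) ?_
    · rwa [hdeg] at h
    · intro i hi
      rw [hdeg] at hi
      rw [← mul_assoc, ← pow_succ]
      exact twoTerm_X_pow_mul_geomPoly hB (by omega) (by omega)
  -- Here too the point at infinity excludes the one bad shift, i = r + α.
  · have hdeg : (geomPoly (-A / B) α (q + 1)).natDegree = s := by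
      rw [natDegree_geomPoly hρ hα0, e2]
      omega
    have h := hasWaringDecomposition_natDegree_add_one (twoTerm r α A B)
      (separable_geomPoly hρ hα0 (q + 1)) (d := r + s + α) ?_
    · rwa [hdeg] at h
    · intro i hi
      rw [hdeg] at hi
      exact twoTerm_X_pow_mul_geomPoly hB (by omega) (by omega)
  · exact hasWaringDecomposition_pencil (q := q) hα (by omega) (by omega) (by omega) (by omega)
      hA hB
  · have hdeg : (geomPoly (-A / B) α (q + 1)).natDegree = r + α - j := by
      rw [natDegree_geomPoly hρ hα0, e2]
      omega
    have h := hasWaringDecomposition_natDegree (twoTerm r α A B)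
      (separable_geomPoly hρ hα0 (q + 1)) (d := r + s + α) ?_
    · rwa [hdeg] at h
    · intro i hi
      rw [hdeg] at hi
      exact twoTerm_X_pow_mul_geomPoly hB (by omega) (by omega)

theorem waringRank_eq {d n : ℕ} {F : MvPolynomial (Fin 2) ℂ} (h : HasWaringDecomposition d F n)
    (hmin : ∀ k, HasWaringDecomposition d F k → n ≤ k) : waringRank d F = n :=
  le_antisymm (iInf₂_le n h) (le_iInf₂ fun k hk => Nat.cast_le.2 (hmin k hk))

theorem mainTheorem1 (r s α q j : ℕ) (δ : ℤ) (hrs : r ≤ s) (hα : 1 ≤ α)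
    (hr : r = q * α + j) (hj : j < α) (hδ : δ = (r : ℤ) + (α : ℤ) - (s : ℤ)) :
    (∀ a b : ℂ, a ≠ 0 → b ≠ 0 →
      waringRank (r + s + α) (binomialForm r s α a b) =
        ((if δ ≤ 0 then s + 1
          else if j = 0 ∧ r = s ∧ 1 < α then s + 2
          else if (j : ℤ) = δ then s + 1
          else if δ < (j : ℤ) then r + α + 1
          else r + α - j : ℕ) : ℕ∞)) ∧
    (∀ a b a' b' : ℂ, a ≠ 0 → b ≠ 0 → a' ≠ 0 → b' ≠ 0 →
      waringRank (r + s + α) (binomialForm r s α a b) =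
        waringRank (r + s + α) (binomialForm r s α a' b')) := by
  have main : ∀ a b : ℂ, a ≠ 0 → b ≠ 0 →
      waringRank (r + s + α) (binomialForm r s α a b) =
        ((if δ ≤ 0 then s + 1
          else if j = 0 ∧ r = s ∧ 1 < α then s + 2
          else if (j : ℤ) = δ then s + 1
          else if δ < (j : ℤ) then r + α + 1
          else r + α - j : ℕ) : ℕ∞) := by
    intro a b ha hb
    rw [waringRank_eq (hasWaringDecomposition_binomialForm hrs hα hr hj ha hb)
      fun k hk => le_of_hasWaringDecomposition hrs hα hr hj ha hb hk]
    have h1 : δ ≤ 0 ↔ r + α ≤ s := by omega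
    have h2 : (j : ℤ) = δ ↔ j + s = r + α := by omega
    have h3 : δ < (j : ℤ) ↔ r + α < j + s := by omega
    simp only [h1, h2, h3]
  exact ⟨main, fun a b a' b' ha hb ha' hb' => (main a b ha hb).trans (main a' b' ha' hb').symm⟩
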